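/- Let $\Omega\subset\mathbb R^3$ be an open, bounded, contractible domain with polyhedral Lipschitz boundary, and let $\mathcal T_H$ be a regular partition of $\Omega$ into finitely many closed non-degenerate tetrahedra: they cover $\overline\Omega$, and any two distinct ones are disjoint or share exactly a common vertex, edge or face. Let $\mathbf H_0(\mathrm{curl})$ be the space of $\mathbf v\in L^2(\Omega,\mathbb C^3)$ with $\mathrm{curl}\,\mathbf v\in L^2(\Omega,\mathbb C^3)$ and vanishing tangential trace on $\partial\Omega$, with norm $\|\mathbf v\|_{\mathbf H(\mathrm{curl})}^2=\|\mathrm{curl}\,\mathbf v\|_{L^2}^2+\|\mathbf v\|_{L^2}^2$, and let $\mathbf H_0(\mathrm{curl})'$ be its space of continuous conjugate-linear functionals. Let $$\mathring{\mathcal N}(\mathcal T_H)=\{\mathbf v\in \mathbf H_0(\mathrm{curl}) : \forall T\in\mathcal T_H\ \exists\, \mathbf a_T,\mathbf b_T\in\mathbb C^3,\ \mathbf v|_T(\mathbf x)=\mathbf a_T\times \mathbf x+\mathbf b_T\}$$ be the lowest order Nédélec space, and let $\pi_H^E:\mathbf H_0(\mathrm{curl})\to\mathring{\mathcal N}(\mathcal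 T_H)$ be any bounded linear projection onto it (for instance the Falk–Winther interpolation operator), with kernel $\mathbf W=\ker\pi_H^E$. Let $\mathbf f\in\mathbf H(\mathrm{div},\Omega)$, i.e. $\mathbf f\in L^2(\Omega,\mathbb C^3)$ with $\mathrm{div}\,\mathbf f\in L^2(\Omega,\mathbb C)$, let $\mu\in L^\infty(\Omega,\mathbb R^{3\times3})$, $\kappa\in L^\infty(\Omega,\mathbb C^{3\times3})$, and put $$\mathcal B(\mathbf v,\boldsymbol\psi)=(\mu\,\mathrm{curl}\,\mathbf v,\mathrm{curl}\,\boldsymbol\psi)_{L^2(\Omega)}+(\kappa\mathbf v,\boldsymbol\psi)_{L^2(\Omega)},\qquad \mathbf v,\boldsymbol\psi\in\mathbf H_0(\mathrm{curl}),$$ with the complex $L^2$ inner product, conjugate-linear in its second argument. Assume that $\mathcal B$ is elliptic: there is $\alpha>0$ with $|\mathcal B(\mathbf v,\mathbf v)|\ge\alpha\|\mathbf v\|_{\mathbf H(\mathrm{curl})}^2$ for all $\mathbf v\in\mathbf H_0(\mathrm{curl})$. Let $\mathcal L:\mathbf H_0(\mathrm{curl})\to\mathbf H_0(\mathrm{curl})'$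 be given by $\mathcal L(\mathbf v)(\mathbf w)=\mathcal B(\mathbf v,\mathbf w)$. Then the following hold. 1. There is exactly one $\mathbf u\in\mathbf H_0(\mathrm{curl})$ with $\mathcal B(\mathbf u,\boldsymbol\psi)=(\mathbf f,\boldsymbol\psi)_{L^2(\Omega)}$ for all $\boldsymbol\psi\in\mathbf H_0(\mathrm{curl})$. 2. For every $\mathbf F\in\mathbf H_0(\mathrm{curl})'$ there is exactly one $\mathcal G(\mathbf F)\in\mathbf W$ with $\mathcal B(\mathcal G(\mathbf F),\mathbf w)=\mathbf F(\mathbf w)$ for all $\mathbf w\in\mathbf W$; this defines the Corrector Green's Operator $\mathcal G:\mathbf H_0(\mathrm{curl})'\to\mathbf W$. 3. The solution $\mathbf u$ of 1. and $\mathbf u_H:=\pi_H^E(\mathbf u)$ satisfy $$\mathbf u=\mathbf u_H-(\mathcal G\circ\mathcal L)(\mathbf u_H)+\mathcal G(\mathbf f),$$ where $\mathcal G(\mathbf f)$ is $\mathcal G$ applied to the functional $\mathbf w\mapsto(\mathbf f,\mathbf w)_{L^2(\Omega)}$. -/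

import Mathlib

open MeasureTheory Topology
open scoped ContDiff NNReal Matrix

noncomputable section

namespace HCurlLOD

/-- The physical space `ℝ³`. -/
abbrev R3 : Type := EuclideanSpace ℝ (Fin 3)

/-- The space of values `ℂ³`. -/
abbrev C3 : Type := EuclideanSpace ℂ (Fin 3)

/-- `Ω` has Lipschitz boundary: near each boundary point, in suitable orthonormal coordinates,
`Ω` is the set of points strictly above the graph of a Lipschitz function of two variables. -/
def HasLipschitzBoundary (Ω : Set R3) : Prop :=
  ∀ x ∈ frontier Ω, ∃ (e : R3 ≃ₗᵢ[ℝ] R3) (g : EuclideanSpace ℝ (Fin 2) → ℝ) (K : ℝ≥0),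
    LipschitzWith K g ∧ ∀ᶠ y in 𝓝 x, (y ∈ Ω ↔ g !₂[e y 0, e y 1] < e y 2)

/-! ### Function spaces -/

/-- `L²(Ω, ℂ³)`, with its inner product (in Mathlib, `inner ℂ w v` is `∫ v · conj w`). -/
abbrev L2 (Ω : Set R3) : Type := Lp C3 2 (volume.restrict Ω)

/-- The partial derivative `∂ⱼ φₖ` of a vector field. -/
def partialDeriv (φ : R3 → C3) (j k : Fin 3) (x : R3) : ℂ :=
  (fderiv ℝ φ x (EuclideanSpace.single j 1)) k

/-- The classical curl of a vector field. -/
def curl (φ : R3 → C3) (x : R3) : C3 :=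
  !₂[partialDeriv φ 1 2 x - partialDeriv φ 2 1 x,
     partialDeriv φ 2 0 x - partialDeriv φ 0 2 x,
     partialDeriv φ 0 1 x - partialDeriv φ 1 0 x]

/-- Smooth compactly supported complex vector fields on `ℝ³`. -/
structure IsTestField (φ : R3 → C3) : Prop where
  smooth : ContDiff ℝ ∞ φ
  compact : HasCompactSupport φ

theorem continuous_curl {φ : R3 → C3} (hφ : IsTestField φ) : Continuous (curl φ) := by
  have h : Continuous (fderiv ℝ φ) := hφ.smooth.continuous_fderiv (by simp)
  have hp : ∀ j k, Continuous (partialDeriv φ j k) := fun j k => by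
    unfold partialDeriv
    fun_prop
  refine (PiLp.continuous_toLp 2 _).comp (continuous_pi fun i => ?_)
  have h1 := fun j k j' k' => (hp j k).sub (hp j' k')
  fin_cases i
  · exact h1 1 2 2 1
  · exact h1 2 0 0 2
  · exact h1 0 1 1 0

theorem hasCompactSupport_curl {φ : R3 → C3} (hφ : IsTestField φ) :
    HasCompactSupport (curl φ) := by
  refine (hφ.compact.fderiv ℝ).mono fun x hx => ?_
  contrapose! hx
  have h : fderiv ℝ φ x = 0 := by simpa using hx
  simp only [Function.mem_support, not_not]
  ext i
  fin_cases i <;> simp [curl, partialDeriv, h]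

theorem integrable_inner_of_test (Ω : Set R3) {φ : R3 → C3} (hc : Continuous φ)
    (hs : HasCompactSupport φ) (v : L2 Ω) :
    Integrable (fun x => inner ℂ (φ x) (v x)) (volume.restrict Ω) := by
  have hm : MemLp φ 2 (volume.restrict Ω) := hc.memLp_of_hasCompactSupport hs
  refine (L2.integrable_inner (𝕜 := ℂ) hm.toLp v).congr ?_
  filter_upwards [hm.coeFn_toLp] with x hx
  rw [hx]

/-- Green's identity `(w, φ)_{L²(Ω)} = (v, curl φ)_{L²(Ω)}`. -/
def CurlPairing (Ω : Set R3) (p : WithLp 2 (L2 Ω × L2 Ω)) (φ : R3 → C3) : Prop :=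
  ∫ x in Ω, inner ℂ (φ x) (p.snd x) = ∫ x in Ω, inner ℂ (curl φ x) (p.fst x)

theorem CurlPairing.zero (Ω : Set R3) (φ : R3 → C3) : CurlPairing Ω 0 φ := by
  have h : ∀ ψ : R3 → C3,
      ∫ x in Ω, inner ℂ (ψ x) ((0 : L2 Ω) x) = 0 := fun ψ => by
    rw [integral_eq_zero_of_ae]
    filter_upwards [Lp.coeFn_zero C3 2 (volume.restrict Ω)] with x hx
    rw [hx, Pi.zero_apply, Pi.zero_apply, inner_zero_right]
  simp only [CurlPairing, WithLp.zero_fst, WithLp.zero_snd, h]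

theorem CurlPairing.add {Ω : Set R3} {p q : WithLp 2 (L2 Ω × L2 Ω)} {φ : R3 → C3}
    (hφ : IsTestField φ) (hp : CurlPairing Ω p φ) (hq : CurlPairing Ω q φ) :
    CurlPairing Ω (p + q) φ := by
  have h : ∀ (ψ : R3 → C3), Continuous ψ → HasCompactSupport ψ → ∀ a b : L2 Ω,
      ∫ x in Ω, inner ℂ (ψ x) ((a + b : L2 Ω) x) =
        (∫ x in Ω, inner ℂ (ψ x) (a x)) + ∫ x in Ω, inner ℂ (ψ x) (b x) := by
    intro ψ hc hs a b
    rw [← integral_add (integrable_inner_of_test Ω hc hs a) (integrable_inner_of_test Ω hc hs b)]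
    refine integral_congr_ae ?_
    filter_upwards [Lp.coeFn_add a b] with x hx
    rw [hx, Pi.add_apply, inner_add_right]
  unfold CurlPairing at *
  rw [WithLp.add_fst, WithLp.add_snd, h _ hφ.smooth.continuous hφ.compact,
    h _ (continuous_curl hφ) (hasCompactSupport_curl hφ), hp, hq]

theorem CurlPairing.smul {Ω : Set R3} (c : ℂ) {p : WithLp 2 (L2 Ω × L2 Ω)} {φ : R3 → C3}
    (hp : CurlPairing Ω p φ) : CurlPairing Ω (c • p) φ := by
  have h : ∀ (ψ : R3 → C3) (a : L2 Ω),
      ∫ x in Ω, inner ℂ (ψ x) ((c • a : L2 Ω) x) = c * ∫ x in Ω, inner ℂ (ψ x) (a x) := by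
    intro ψ a
    rw [← integral_const_mul]
    refine integral_congr_ae ?_
    filter_upwards [Lp.coeFn_smul c a] with x hx
    rw [hx, Pi.smul_apply, inner_smul_right]
  unfold CurlPairing at *
  rw [WithLp.smul_fst, WithLp.smul_snd, h, h, hp]

/-- `H(curl, Ω)`, realised as the space of pairs `(v, curl v)`: the second component is the weak
curl of the first, i.e. Green's identity holds for all test fields supported in `Ω`. The inner
product inherited from the Hilbert sum is `(curl v, curl w)_{L²} + (v, w)_{L²}`. -/
def Hcurl (Ω : Set R3) : Submodule ℂ (WithLp 2 (L2 Ω × L2 Ω)) where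
  carrier := {p | ∀ φ, IsTestField φ → tsupport φ ⊆ Ω → CurlPairing Ω p φ}
  zero_mem' := fun φ _ _ => CurlPairing.zero Ω φ
  add_mem' := fun hp hq φ hφ hs => (hp φ hφ hs).add hφ (hq φ hφ hs)
  smul_mem' := fun c _ hp φ hφ hs => (hp φ hφ hs).smul c

/-- `H₀(curl, Ω)`: the elements of `H(curl, Ω)` whose tangential trace `v × n` on `∂Ω` vanishes,
i.e. those for which the boundary term `∫_Ω curl v · φ - ∫_Ω v · curl φ` in Green's formula is zero
for all smooth fields `φ` up to the boundary. -/
def Hcurl0 (Ω : Set R3) : Submodule ℂ (WithLp 2 (L2 Ω × L2 Ω)) where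
  carrier := {p | p ∈ Hcurl Ω ∧ ∀ φ, IsTestField φ → CurlPairing Ω p φ}
  zero_mem' := ⟨(Hcurl Ω).zero_mem, fun φ _ => CurlPairing.zero Ω φ⟩
  add_mem' := fun hp hq =>
    ⟨(Hcurl Ω).add_mem hp.1 hq.1, fun φ hφ => (hp.2 φ hφ).add hφ (hq.2 φ hφ)⟩
  smul_mem' := fun c _ hp => ⟨(Hcurl Ω).smul_mem c hp.1, fun φ hφ => (hp.2 φ hφ).smul c⟩

/-- The inclusion `H₀(curl, Ω) → L²(Ω, ℂ³)`, `v ↦ v`. -/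
def valL (Ω : Set R3) : Hcurl0 Ω →L[ℂ] L2 Ω :=
  (WithLp.fstL 2 ℂ (L2 Ω) (L2 Ω)).comp (Hcurl0 Ω).subtypeL

/-- The weak curl `H₀(curl, Ω) → L²(Ω, ℂ³)`, `v ↦ curl v`. -/
def curlL (Ω : Set R3) : Hcurl0 Ω →L[ℂ] L2 Ω :=
  (WithLp.sndL 2 ℂ (L2 Ω) (L2 Ω)).comp (Hcurl0 Ω).subtypeL

/-- `H₀(curl, Ω)'`: the continuous conjugate-linear functionals. -/
abbrev Hcurl0Dual (Ω : Set R3) : Type := Hcurl0 Ω →L⋆[ℂ] ℂ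

/-- `f ∈ H(div, Ω)`: `f ∈ L²(Ω, ℂ³)` has a weak divergence in `L²(Ω, ℂ)`. -/
def MemHdiv (Ω : Set R3) (f : L2 Ω) : Prop :=
  ∃ d : Lp ℂ 2 (volume.restrict Ω), ∀ φ : R3 → ℂ, ContDiff ℝ ∞ φ → HasCompactSupport φ →
    tsupport φ ⊆ Ω →
    ∫ x in Ω, ∑ j, f x j * fderiv ℝ φ x (EuclideanSpace.single j 1) = -∫ x in Ω, d x * φ x

/-! ### The sesquilinear form -/

/-- Matrix fields with entries in `L^∞(Ω)`. -/
def IsLinftyMatrix {𝕜 : Type*} [NormedField 𝕜] (Ω : Set R3)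
    (A : R3 → Matrix (Fin 3) (Fin 3) 𝕜) : Prop :=
  ∀ i j, MemLp (fun x => A x i j) ⊤ (volume.restrict Ω)

theorem IsLinftyMatrix.ofReal {Ω : Set R3} {A : R3 → Matrix (Fin 3) (Fin 3) ℝ}
    (hA : IsLinftyMatrix Ω A) : IsLinftyMatrix Ω fun x => (A x).map Complex.ofReal :=
  fun i j => (hA i j).ofReal (K := ℂ)

theorem IsLinftyMatrix.memLp_mulVec {Ω : Set R3} {A : R3 → Matrix (Fin 3) (Fin 3) ℂ}
    (hA : IsLinftyMatrix Ω A) (v : L2 Ω) :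
    MemLp (fun x => WithLp.toLp 2 (A x *ᵥ (v x).ofLp) : R3 → C3) 2 (volume.restrict Ω) := by
  refine MemLp.of_eval_piLp fun i => ?_
  have hv : ∀ j, MemLp (fun x => v x j) 2 (volume.restrict Ω) := fun j => (Lp.memLp v).eval_piLp j
  have h := memLp_finsetSum Finset.univ fun j _ => (hv j).mul (hA i j) (r := 2)
  simpa [Matrix.mulVec, dotProduct] using h

/-- The product `A v ∈ L²(Ω, ℂ³)` of a bounded matrix field with an `L²` field. -/
def mulField {Ω : Set R3} {A : R3 → Matrix (Fin 3) (Fin 3) ℂ} (hA : IsLinftyMatrix Ω A)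
    (v : L2 Ω) : L2 Ω :=
  (hA.memLp_mulVec v).toLp

/-- The form `B(v, ψ) = (μ curl v, curl ψ)_{L²(Ω)} + (κ v, ψ)_{L²(Ω)}` on `H₀(curl, Ω)`. -/
def sesqForm {Ω : Set R3} {μ : R3 → Matrix (Fin 3) (Fin 3) ℝ}
    {κ : R3 → Matrix (Fin 3) (Fin 3) ℂ} (hμ : IsLinftyMatrix Ω μ) (hκ : IsLinftyMatrix Ω κ)
    (v ψ : Hcurl0 Ω) : ℂ :=
  inner ℂ (curlL Ω ψ) (mulField hμ.ofReal (curlL Ω v)) +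
    inner ℂ (valL Ω ψ) (mulField hκ (valL Ω v))

/-- The form is `H₀(curl, Ω)`-elliptic. -/
def IsElliptic {Ω : Set R3} {μ : R3 → Matrix (Fin 3) (Fin 3) ℝ}
    {κ : R3 → Matrix (Fin 3) (Fin 3) ℂ} (hμ : IsLinftyMatrix Ω μ) (hκ : IsLinftyMatrix Ω κ) :
    Prop :=
  ∃ α : ℝ, 0 < α ∧ ∀ v : Hcurl0 Ω, α * ‖v‖ ^ 2 ≤ ‖sesqForm hμ hκ v v‖

/-- A field `g ∈ L²(Ω, ℂ³)` as the functional `ψ ↦ (g, ψ)_{L²(Ω)}` on `H₀(curl, Ω)`. -/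
def functionalOf {Ω : Set R3} (g : L2 Ω) : Hcurl0Dual Ω :=
  (innerSLFlip ℂ g).comp (valL Ω)

/-- The operator `𝓛 : H₀(curl, Ω) → H₀(curl, Ω)'`, `𝓛(v)(ψ) = B(v, ψ)`. -/
def opL {Ω : Set R3} {μ : R3 → Matrix (Fin 3) (Fin 3) ℝ}
    {κ : R3 → Matrix (Fin 3) (Fin 3) ℂ} (hμ : IsLinftyMatrix Ω μ) (hκ : IsLinftyMatrix Ω κ)
    (v : Hcurl0 Ω) : Hcurl0Dual Ω :=
  (innerSLFlip ℂ (mulField hμ.ofReal (curlL Ω v))).comp (curlL Ω) +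
    (innerSLFlip ℂ (mulField hκ (valL Ω v))).comp (valL Ω)

theorem opL_apply {Ω : Set R3} {μ : R3 → Matrix (Fin 3) (Fin 3) ℝ}
    {κ : R3 → Matrix (Fin 3) (Fin 3) ℂ} (hμ : IsLinftyMatrix Ω μ) (hκ : IsLinftyMatrix Ω κ)
    (v ψ : Hcurl0 Ω) : opL hμ hκ v ψ = sesqForm hμ hκ v ψ := rfl

/-- `u ∈ H₀(curl, Ω)` solves `B(u, ψ) = (f, ψ)_{L²(Ω)}` for all `ψ ∈ H₀(curl, Ω)`. -/
def IsExactSolution {Ω : Set R3} {μ : R3 → Matrix (Fin 3) (Fin 3) ℝ}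
    {κ : R3 → Matrix (Fin 3) (Fin 3) ℂ} (hμ : IsLinftyMatrix Ω μ) (hκ : IsLinftyMatrix Ω κ)
    (f : L2 Ω) (u : Hcurl0 Ω) : Prop :=
  ∀ ψ : Hcurl0 Ω, sesqForm hμ hκ u ψ = inner ℂ (valL Ω ψ) f

/-! ### Meshes and the Nédélec space -/

/-- A regular partition of `Ω` into closed tetrahedra, each given by its set of four vertices:
the tetrahedra cover `closure Ω`, and any two of them meet in the simplex spanned by their common
vertices (the empty set, a vertex, an edge or a face). -/
structure TetMesh (Ω : Set R3) where
  cells : Finset (Finset R3)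
  card_eq : ∀ T ∈ cells, T.card = 4
  affineIndependent : ∀ T ∈ cells, AffineIndependent ℝ ((↑) : T → R3)
  cover : ⋃ T ∈ cells, convexHull ℝ (T : Set R3) = closure Ω
  inter : ∀ T ∈ cells, ∀ T' ∈ cells, convexHull ℝ (T : Set R3) ∩ convexHull ℝ (T' : Set R3) =
    convexHull ℝ ((T : Set R3) ∩ (T' : Set R3))

/-- The field `x ↦ a × x + b` with `a, b ∈ ℂ³`. -/
def nedelecField (a b : Fin 3 → ℂ) (x : R3) : C3 :=
  WithLp.toLp 2 (a ⨯₃ (fun i => ((x i : ℝ) : ℂ)) + b)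

/-- The lowest order Nédélec space: the elements of `H₀(curl, Ω)` that on every tetrahedron `T`
are of the form `x ↦ a_T × x + b_T`. -/
def nedelec {Ω : Set R3} (𝓣 : TetMesh Ω) : Submodule ℂ (Hcurl0 Ω) where
  carrier := {v | ∀ T ∈ 𝓣.cells, ∃ a b : Fin 3 → ℂ, ∀ᵐ x ∂(volume.restrict Ω),
    x ∈ convexHull ℝ (T : Set R3) → valL Ω v x = nedelecField a b x}
  zero_mem' := fun T _ => ⟨0, 0, by
    rw [map_zero]
    filter_upwards [Lp.coeFn_zero C3 2 (volume.restrict Ω)] with x hx _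
    rw [hx]
    simp [nedelecField]⟩
  add_mem' := by
    intro v w hv hw T hT
    obtain ⟨a, b, h⟩ := hv T hT
    obtain ⟨a', b', h'⟩ := hw T hT
    refine ⟨a + a', b + b', ?_⟩
    rw [map_add]
    filter_upwards [h, h', Lp.coeFn_add (valL Ω v) (valL Ω w)] with x hx hx' hs hT
    rw [hs, Pi.add_apply, hx hT, hx' hT]
    simp only [nedelecField, ← WithLp.toLp_add, map_add, LinearMap.add_apply]
    congr 1
    abel
  smul_mem' := by
    intro c v hv T hT
    obtain ⟨a, b, h⟩ := hv T hT
    refine ⟨c • a, c • b, ?_⟩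
    rw [map_smul]
    filter_upwards [h, Lp.coeFn_smul c (valL Ω v)] with x hx hs hT
    rw [hs, Pi.smul_apply, hx hT]
    simp only [nedelecField, ← WithLp.toLp_smul, map_smul, LinearMap.smul_apply, smul_add]

/-! ### The Corrector Green's Operator -/

/-- The Corrector Green's Operator on a subspace `W` of `H₀(curl, Ω)`: `G(F)` is the (unique)
`g ∈ W` with `B(g, w) = F(w)` for all `w ∈ W`. -/
def correctorGreen {Ω : Set R3} {μ : R3 → Matrix (Fin 3) (Fin 3) ℝ}
    {κ : R3 → Matrix (Fin 3) (Fin 3) ℂ} (hμ : IsLinftyMatrix Ω μ) (hκ : IsLinftyMatrix Ω κ)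
    (W : Submodule ℂ (Hcurl0 Ω)) (F : Hcurl0Dual Ω) : W :=
  Classical.epsilon fun g : W => ∀ w : W, sesqForm hμ hκ g w = F w

end HCurlLOD

end

open HCurlLOD

/-!
The statement is a form of the Lax–Milgram lemma, applied once on `H₀(curl, Ω)` and once on the
kernel `W` of the projection.

The form `B` is represented as `B(v, ψ) = ⟪ψ, A v⟫` by a bounded operator `A` on `H₀(curl, Ω)`
(`sesqOp`), which uses that multiplication by an `L^∞` matrix field is bounded on `L²` (`mulFieldL`).
The space `H₀(curl, Ω)` is complete, since Green's identities are closed conditions on the pair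
`(v, curl v)` (`isClosed_Hcurl0`), and `W` is complete as the kernel of a continuous map. The
ellipticity `|B(v, v)| ≥ α ‖v‖²` survives compression of `A` to any complete subspace, and an
operator with such a lower bound is invertible; with the Riesz representation theorem this gives
unique solvability of the variational problem on every complete subspace
(`existsUnique_sesqForm_eq`), hence of the original problem and of the corrector problem.

For the decomposition, `u - π u` belongs to `W` because `π` is a projection, and
`B(u - π u, w) = (f, w) - 𝓛(π u)(w)` for `w ∈ W`. The element `G(f) - G(𝓛(π u))` of `W` solves the
same problem, so the two agree by uniqueness (`sub_eq_correctorGreen_sub`).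
-/

/-! ### Complex Lax–Milgram -/

/-- Solvability on a complete inner product space of the variational problem for a bounded operator
whose quadratic form is bounded below in modulus, with a conjugate-linear right-hand side. -/
theorem existsUnique_inner_eq_of_le_norm_inner {E : Type*} [NormedAddCommGroup E]
    [InnerProductSpace ℂ E] [CompleteSpace E] (A : E →L[ℂ] E) {α : ℝ} (hα : 0 < α)
    (hA : ∀ v, α * ‖v‖ ^ 2 ≤ ‖(inner ℂ v (A v) : ℂ)‖) (F : E →L⋆[ℂ] ℂ) :
    ∃! g : E, ∀ w, inner ℂ w (A g) = F w := by
  have hunit : IsUnit A :=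
    A.isUnit_of_forall_le_norm_inner_map (c := ⟨α, hα.le⟩) hα fun x => by
      rw [norm_inner_symm, mul_comm]
      exact hA x
  have hbij : Function.Bijective A := ContinuousLinearMap.isUnit_iff_bijective.1 hunit
  -- The Riesz representative of the linear functional `w ↦ conj (F w)`.
  obtain ⟨r, hr⟩ : ∃ r : E, ∀ w, inner ℂ w r = F w := by
    refine ⟨(InnerProductSpace.toDual ℂ E).symm
      ((starL ℂ : ℂ ≃L⋆[ℂ] ℂ).toContinuousLinearMap.comp F), fun w => ?_⟩
    rw [← inner_conj_symm, InnerProductSpace.toDual_symm_apply]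
    simp
  obtain ⟨g, hg⟩ := hbij.2 r
  refine ⟨g, fun w => by rw [hg, hr], fun g' hg' => hbij.1 (ext_inner_left ℂ fun w => ?_)⟩
  rw [hg' w, hg, hr]

/-- Galerkin version: the bound on the whole space gives solvability on each complete subspace. -/
theorem Submodule.existsUnique_inner_eq_of_le_norm_inner {E : Type*} [NormedAddCommGroup E]
    [InnerProductSpace ℂ E] (A : E →L[ℂ] E) {α : ℝ} (hα : 0 < α)
    (hA : ∀ v, α * ‖v‖ ^ 2 ≤ ‖(inner ℂ v (A v) : ℂ)‖) (W : Submodule ℂ E) [CompleteSpace W]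
    (F : E →L⋆[ℂ] ℂ) : ∃! g : W, ∀ w : W, inner ℂ (w : E) (A g) = F w := by
  -- The compression of `A` to `W`.
  have key : ∀ g w : W, (inner ℂ w ((W.orthogonalProjectionOnto.comp (A.comp W.subtypeL)) g) : ℂ) =
      inner ℂ (w : E) (A g) := fun g w => by
    simp
  simpa only [key] using! _root_.existsUnique_inner_eq_of_le_norm_inner
    (W.orthogonalProjectionOnto.comp (A.comp W.subtypeL)) hα
    (fun v => by rw [key]; exact hA v) (F.comp W.subtypeL)

namespace HCurlLOD

/-! ### Completeness of `H₀(curl, Ω)` -/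

theorem integral_inner_eq_inner_toLp {Ω : Set R3} {φ : R3 → C3}
    (hφ : MemLp φ 2 (volume.restrict Ω)) (v : L2 Ω) :
    ∫ x in Ω, inner ℂ (φ x) (v x) = inner ℂ hφ.toLp v := by
  rw [L2.inner_def]
  refine integral_congr_ae ?_
  filter_upwards [hφ.coeFn_toLp] with x hx
  rw [hx]

theorem isClosed_setOf_curlPairing (Ω : Set R3) {φ : R3 → C3} (hφ : IsTestField φ) :
    IsClosed {p : WithLp 2 (L2 Ω × L2 Ω) | CurlPairing Ω p φ} := by
  have h : MemLp φ 2 (volume.restrict Ω) :=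
    hφ.smooth.continuous.memLp_of_hasCompactSupport hφ.compact
  have h' : MemLp (curl φ) 2 (volume.restrict Ω) :=
    (continuous_curl hφ).memLp_of_hasCompactSupport (hasCompactSupport_curl hφ)
  simp only [CurlPairing, integral_inner_eq_inner_toLp h, integral_inner_eq_inner_toLp h']
  exact isClosed_eq (continuous_const.inner (WithLp.sndL 2 ℂ (L2 Ω) (L2 Ω)).continuous)
    (continuous_const.inner (WithLp.fstL 2 ℂ (L2 Ω) (L2 Ω)).continuous)

theorem isClosed_Hcurl0 (Ω : Set R3) : IsClosed (Hcurl0 Ω : Set (WithLp 2 (L2 Ω × L2 Ω))) := by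
  -- Green's identity for all test fields includes the one for test fields supported in `Ω`.
  have h : (Hcurl0 Ω : Set (WithLp 2 (L2 Ω × L2 Ω))) =
      ⋂ φ, ⋂ _ : IsTestField φ, {p | CurlPairing Ω p φ} := by
    ext p
    simp only [Set.mem_iInter]
    exact ⟨fun hp => hp.2, fun hp => ⟨fun φ hφ _ => hp φ hφ, hp⟩⟩
  rw [h]
  exact isClosed_iInter fun φ => isClosed_iInter fun hφ => isClosed_setOf_curlPairing Ω hφ

instance (Ω : Set R3) : CompleteSpace (Hcurl0 Ω) :=
  (isClosed_Hcurl0 Ω).completeSpace_coe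

/-! ### The operator of the sesquilinear form -/

theorem IsLinftyMatrix.exists_ae_norm_mulVec_le {Ω : Set R3} {A : R3 → Matrix (Fin 3) (Fin 3) ℂ}
    (hA : IsLinftyMatrix Ω A) : ∃ C : ℝ, ∀ᵐ x ∂(volume.restrict Ω), ∀ z : C3,
      ‖(WithLp.toLp 2 (A x *ᵥ z.ofLp) : C3)‖ ≤ C * ‖z‖ := by
  refine ⟨∑ i, ∑ j, lpNorm (fun x => A x i j) ⊤ (volume.restrict Ω), ?_⟩
  have h : ∀ᵐ x ∂(volume.restrict Ω), ∀ i j,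
      ‖A x i j‖ ≤ lpNorm (fun x => A x i j) ⊤ (volume.restrict Ω) :=
    ae_all_iff.2 fun i => ae_all_iff.2 fun j => ae_le_lpNorm_exponent_top (hA i j)
  filter_upwards [h] with x hx z
  -- The Euclidean norm is at most the sum of the moduli of the coordinates.
  have hsum : ∀ y : C3, ‖y‖ ≤ ∑ i, ‖y i‖ := fun y => by
    rw [EuclideanSpace.norm_eq]
    exact Real.sqrt_le_iff.2 ⟨by positivity,
      Finset.sum_sq_le_sq_sum_of_nonneg fun i _ => norm_nonneg _⟩
  refine (hsum _).trans ?_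
  rw [Finset.sum_mul]
  refine Finset.sum_le_sum fun i _ => ?_
  rw [Finset.sum_mul]
  refine (norm_sum_le Finset.univ fun j => A x i j * z j).trans (Finset.sum_le_sum fun j _ => ?_)
  rw [norm_mul]
  exact mul_le_mul (hx i j) (PiLp.norm_apply_le z j) (norm_nonneg _)
    ((norm_nonneg _).trans (hx i j))

theorem coeFn_mulField {Ω : Set R3} {A : R3 → Matrix (Fin 3) (Fin 3) ℂ} (hA : IsLinftyMatrix Ω A)
    (v : L2 Ω) :
    mulField hA v =ᵐ[volume.restrict Ω] fun x => WithLp.toLp 2 (A x *ᵥ (v x).ofLp) :=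
  (hA.memLp_mulVec v).coeFn_toLp

/-- Multiplication by a bounded matrix field, as a bounded operator on `L²(Ω, ℂ³)`. -/
noncomputable def mulFieldL {Ω : Set R3} {A : R3 → Matrix (Fin 3) (Fin 3) ℂ} (hA : IsLinftyMatrix Ω A) :
    L2 Ω →L[ℂ] L2 Ω :=
  LinearMap.mkContinuousOfExistsBound
    { toFun := mulField hA
      map_add' := fun v w => by
        refine Lp.ext ?_
        filter_upwards [coeFn_mulField hA (v + w), coeFn_mulField hA v, coeFn_mulField hA w,
          Lp.coeFn_add v w, Lp.coeFn_add (mulField hA v) (mulField hA w)] with x h₁ h₂ h₃ h₄ h₅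
        rw [h₁, h₅, Pi.add_apply, h₂, h₃, h₄, Pi.add_apply, WithLp.ofLp_add, Matrix.mulVec_add,
          WithLp.toLp_add]
      map_smul' := fun c v => by
        refine Lp.ext ?_
        filter_upwards [coeFn_mulField hA (c • v), coeFn_mulField hA v,
          Lp.coeFn_smul c v, Lp.coeFn_smul c (mulField hA v)] with x h₁ h₂ h₃ h₄
        rw [h₁, RingHom.id_apply, h₄, Pi.smul_apply, h₂, h₃, Pi.smul_apply, WithLp.ofLp_smul,
          Matrix.mulVec_smul, WithLp.toLp_smul] }
    (by
      obtain ⟨C, hC⟩ := hA.exists_ae_norm_mulVec_le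
      refine ⟨C, fun v => Lp.norm_le_mul_norm_of_ae_le_mul ?_⟩
      filter_upwards [hC, coeFn_mulField hA v] with x hx hv
      exact hv ▸ hx (v x))

/-- The bounded operator `A` on `H₀(curl, Ω)` with `B(v, ψ) = ⟪ψ, A v⟫`. -/
noncomputable def sesqOp {Ω : Set R3} {μ : R3 → Matrix (Fin 3) (Fin 3) ℝ}
    {κ : R3 → Matrix (Fin 3) (Fin 3) ℂ} (hμ : IsLinftyMatrix Ω μ) (hκ : IsLinftyMatrix Ω κ) :
    Hcurl0 Ω →L[ℂ] Hcurl0 Ω :=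
  (curlL Ω).adjoint.comp ((mulFieldL hμ.ofReal).comp (curlL Ω)) +
    (valL Ω).adjoint.comp ((mulFieldL hκ).comp (valL Ω))

theorem inner_sesqOp {Ω : Set R3} {μ : R3 → Matrix (Fin 3) (Fin 3) ℝ}
    {κ : R3 → Matrix (Fin 3) (Fin 3) ℂ} (hμ : IsLinftyMatrix Ω μ) (hκ : IsLinftyMatrix Ω κ)
    (v ψ : Hcurl0 Ω) : inner ℂ ψ (sesqOp hμ hκ v) = sesqForm hμ hκ v ψ := by
  simp only [sesqOp, add_apply, ContinuousLinearMap.comp_apply, inner_add_right,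
    ContinuousLinearMap.adjoint_inner_right]
  rfl

theorem sesqForm_sub_left {Ω : Set R3} {μ : R3 → Matrix (Fin 3) (Fin 3) ℝ}
    {κ : R3 → Matrix (Fin 3) (Fin 3) ℂ} (hμ : IsLinftyMatrix Ω μ) (hκ : IsLinftyMatrix Ω κ)
    (v v' ψ : Hcurl0 Ω) :
    sesqForm hμ hκ (v - v') ψ = sesqForm hμ hκ v ψ - sesqForm hμ hκ v' ψ := by
  simp only [← inner_sesqOp, map_sub, inner_sub_right]

/-! ### Variational problems on subspaces -/

theorem existsUnique_sesqForm_eq {Ω : Set R3} {μ : R3 → Matrix (Fin 3) (Fin 3) ℝ}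
    {κ : R3 → Matrix (Fin 3) (Fin 3) ℂ} {hμ : IsLinftyMatrix Ω μ} {hκ : IsLinftyMatrix Ω κ}
    (hB : IsElliptic hμ hκ) (W : Submodule ℂ (Hcurl0 Ω)) [CompleteSpace W] (F : Hcurl0Dual Ω) :
    ∃! g : W, ∀ w : W, sesqForm hμ hκ g w = F w := by
  obtain ⟨α, hα, h⟩ := hB
  simpa only [inner_sesqOp] using W.existsUnique_inner_eq_of_le_norm_inner (sesqOp hμ hκ) hα
    (fun v => by rw [inner_sesqOp]; exact h v) F

theorem existsUnique_isExactSolution {Ω : Set R3} {μ : R3 → Matrix (Fin 3) (Fin 3) ℝ}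
    {κ : R3 → Matrix (Fin 3) (Fin 3) ℂ} {hμ : IsLinftyMatrix Ω μ} {hκ : IsLinftyMatrix Ω κ}
    (hB : IsElliptic hμ hκ) (f : L2 Ω) : ∃! u : Hcurl0 Ω, IsExactSolution hμ hκ f u := by
  obtain ⟨α, hα, h⟩ := hB
  simpa only [inner_sesqOp] using! existsUnique_inner_eq_of_le_norm_inner (sesqOp hμ hκ) hα
    (fun v => by rw [inner_sesqOp]; exact h v) (functionalOf f)

theorem forall_sesqForm_eq_iff_eq_correctorGreen {Ω : Set R3} {μ : R3 → Matrix (Fin 3) (Fin 3) ℝ}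
    {κ : R3 → Matrix (Fin 3) (Fin 3) ℂ} {hμ : IsLinftyMatrix Ω μ} {hκ : IsLinftyMatrix Ω κ}
    (hB : IsElliptic hμ hκ) (W : Submodule ℂ (Hcurl0 Ω)) [CompleteSpace W] (F : Hcurl0Dual Ω)
    (g : W) :
    (∀ w : W, sesqForm hμ hκ g w = F w) ↔ g = correctorGreen hμ hκ W F := by
  have hex := existsUnique_sesqForm_eq hB W F
  have hspec : ∀ w : W, sesqForm hμ hκ (correctorGreen hμ hκ W F) w = F w :=
    Classical.epsilon_spec (p := fun g : W => ∀ w : W, sesqForm hμ hκ g w = F w) hex.exists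
  exact ⟨fun hg => hex.unique hg hspec, fun hg => hg ▸ hspec⟩

/-- If `u` solves the problem with right-hand side `F` and `v` differs from `u` by an element of `W`,
then `u - v` is determined by the corrector problems for `F` and `𝓛 v`. -/
theorem sub_eq_correctorGreen_sub {Ω : Set R3} {μ : R3 → Matrix (Fin 3) (Fin 3) ℝ}
    {κ : R3 → Matrix (Fin 3) (Fin 3) ℂ} {hμ : IsLinftyMatrix Ω μ} {hκ : IsLinftyMatrix Ω κ}
    (hB : IsElliptic hμ hκ) (W : Submodule ℂ (Hcurl0 Ω)) [CompleteSpace W] {F : Hcurl0Dual Ω}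
    {u v : Hcurl0 Ω} (hu : ∀ ψ, sesqForm hμ hκ u ψ = F ψ) (huv : u - v ∈ W) :
    u - v = (correctorGreen hμ hκ W F : Hcurl0 Ω) - correctorGreen hμ hκ W (opL hμ hκ v) := by
  have hG : ∀ F (w : W), sesqForm hμ hκ (correctorGreen hμ hκ W F) w = F w := fun F =>
    (forall_sesqForm_eq_iff_eq_correctorGreen hB W F _).2 rfl
  -- Both sides solve the corrector problem whose right-hand side is the residual `F - 𝓛 v`.
  have h := (existsUnique_sesqForm_eq hB W (F - opL hμ hκ v)).unique
    (y₁ := ⟨u - v, huv⟩)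
    (y₂ := correctorGreen hμ hκ W F - correctorGreen hμ hκ W (opL hμ hκ v))
    (fun w => by rw [sesqForm_sub_left, hu, sub_apply, opL_apply])
    (fun w => by rw [Submodule.coe_sub, sesqForm_sub_left, hG, hG, sub_apply])
  exact congrArg Subtype.val h

end HCurlLOD

theorem mainTheorem8 (Ω : Set R3) (hΩ_open : IsOpen Ω) (hΩ_bdd : Bornology.IsBounded Ω)
    (hΩ_contr : ContractibleSpace Ω) (hΩ_lip : HasLipschitzBoundary Ω)
    (𝓣 : TetMesh Ω)
    (μ : R3 → Matrix (Fin 3) (Fin 3) ℝ) (hμ : IsLinftyMatrix Ω μ)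
    (κ : R3 → Matrix (Fin 3) (Fin 3) ℂ) (hκ : IsLinftyMatrix Ω κ)
    (hB : IsElliptic hμ hκ)
    (f : L2 Ω) (hf : MemHdiv Ω f)
    (πE : Hcurl0 Ω →L[ℂ] nedelec 𝓣) (hπE : ∀ v : nedelec 𝓣, πE (v : Hcurl0 Ω) = v) :
    -- the problem has exactly one solution
    (∃! u : Hcurl0 Ω, IsExactSolution hμ hκ f u) ∧
    -- the Corrector Green's Operator onto the kernel of the projection is well defined
    (∀ (F : Hcurl0Dual Ω) (g : πE.ker),
      (∀ w : πE.ker, sesqForm hμ hκ g w = F w) ↔ g = correctorGreen hμ hκ πE.ker F) ∧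
    -- the decomposition of the exact solution
    (∀ u : Hcurl0 Ω, IsExactSolution hμ hκ f u →
      u = (πE u : Hcurl0 Ω) - (correctorGreen hμ hκ πE.ker (opL hμ hκ (πE u)) : Hcurl0 Ω)
        + (correctorGreen hμ hκ πE.ker (functionalOf f) : Hcurl0 Ω)) := by
  have : CompleteSpace πE.ker := πE.isClosed_ker.completeSpace_coe
  refine ⟨existsUnique_isExactSolution hB f,
    forall_sesqForm_eq_iff_eq_correctorGreen hB πE.ker, fun u hu => ?_⟩
  have hmem : u - (πE u : Hcurl0 Ω) ∈ πE.ker := by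
    rw [LinearMap.mem_ker, map_sub]
    exact sub_eq_zero.2 (hπE (πE u)).symm
  have h := sub_eq_correctorGreen_sub hB πE.ker (F := functionalOf f) hu hmem
  rw [sub_eq_iff_eq_add] at h
  exact h.trans (by abel)
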